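/- Let $\phi:[0,1]\to\mathbb{R}$ and $\alpha\in\mathbb{R}$. For a positive integer $\ell$, say that the $\ell$th divergence speed of $\phi$ is $p^\alpha$ if $\phi$ is $\ell$ times continuously differentiable on $(0,1)$ and there are constants $W>0$, $c\ge 0$, $c'\ge 0$ such that for all $p\in(0,1)$ $$W p^{-\ell+\alpha}-c' \le |\phi^{(\ell)}(p)| \le W p^{-\ell+\alpha}+c .$$ For an integer $L\ge 0$ and an interval $I\subseteq[0,1]$ let $$E_L(\phi,I)=\inf_{g}\ \sup_{x\in I}|\phi(x)-g(x)|,$$ where $g$ ranges over all real polynomials of degree at most $L$. Theorem. Suppose that $\phi$ is continuous at $0$ and that one of the following conditions holds: (1) $\alpha\in(0,1/2]$ and the first divergence speed of $\phi$ is $p^\alpha$; (2) $\alpha\in(1/2,1]$ and the second divergence speed of $\phi$ is $p^\alpha$; (3) $\alpha\in(1,3/2)$ and the third divergence speed of $\phi$ is $p^\alpha$. Then there is a constant $C>0$, depending only on $\phi$ and $\alpha$, such that for all integers $L\ge 1$ and all $\lambda\in(0,1)$ $$E_L(\phi,[0,\lambda])\le C\left(\frac{\lambda}{L^2}\right)^\alpha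 .$$ -/

import Mathlib

/-- The `ℓ`th divergence speed of `φ` is `p ^ α` (for `1 ≤ ℓ`): `φ` is `ℓ` times continuously
differentiable on the open interval `(0,1)`, and on `(0,1)` the absolute value of its `ℓ`th
derivative equals `W * p ^ (α - ℓ)` up to additive constants. Only the values of `φ` on `(0,1)`
matter. -/
def HasDivergenceSpeed (ℓ : ℕ) (φ : ℝ → ℝ) (α : ℝ) : Prop :=
  ContDiffOn ℝ (ℓ : WithTop ℕ∞) φ (Set.Ioo 0 1) ∧
    ∃ W c c' : ℝ, 0 < W ∧ 0 ≤ c ∧ 0 ≤ c' ∧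
      ∀ p ∈ Set.Ioo (0 : ℝ) 1,
        W * p ^ (-(ℓ : ℝ) + α) - c' ≤ |iteratedDeriv ℓ φ p| ∧
          |iteratedDeriv ℓ φ p| ≤ W * p ^ (-(ℓ : ℝ) + α) + c

/-- The best uniform approximation error `E_L(φ, I) = inf_g sup_{x ∈ I} |φ x - g x|`, where `g`
runs over the real polynomials of degree at most `L`. It takes values in `[0, ∞]`, so that
the supremum and the infimum are the true ones. -/
noncomputable def bestPolyError (L : ℕ) (φ : ℝ → ℝ) (I : Set ℝ) : ENNReal :=
  ⨅ (g : Polynomial ℝ) (_ : g.natDegree ≤ L), ⨆ x ∈ I, ENNReal.ofReal |φ x - g.eval x|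

open Real Finset intervalIntegral

/-- Trigonometric polynomials of degree at most `n`. -/
def trigPoly (n : ℕ) : Submodule ℝ (ℝ → ℝ) :=
  Submodule.span ℝ {f | ∃ k : ℕ, k ≤ n ∧
    ((f = fun t => Real.cos (k * t)) ∨ f = fun t => Real.sin (k * t))}

theorem cos_nat_mem_trigPoly {n k : ℕ} (h : k ≤ n) :
    (fun t : ℝ => Real.cos (k * t)) ∈ trigPoly n :=
  Submodule.subset_span ⟨k, h, Or.inl rfl⟩

theorem sin_nat_mem_trigPoly {n k : ℕ} (h : k ≤ n) :
    (fun t : ℝ => Real.sin (k * t)) ∈ trigPoly n :=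
  Submodule.subset_span ⟨k, h, Or.inr rfl⟩

theorem cos_int_mem_trigPoly {n : ℕ} {z : ℤ} (h : z.natAbs ≤ n) :
    (fun t : ℝ => Real.cos (z * t)) ∈ trigPoly n := by
  have h1 := cos_nat_mem_trigPoly h
  rcases Int.natAbs_eq z with h2 | h2
  · rw [h2]; simpa using h1
  · rw [h2]
    convert h1 using 2
    simp

theorem sin_int_mem_trigPoly {n : ℕ} {z : ℤ} (h : z.natAbs ≤ n) :
    (fun t : ℝ => Real.sin (z * t)) ∈ trigPoly n := by
  have h1 := sin_nat_mem_trigPoly h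
  rcases Int.natAbs_eq z with h2 | h2
  · rw [h2]; simpa using h1
  · rw [h2]
    convert (trigPoly n).neg_mem h1 using 1
    ext t
    simp

theorem mul_cos_mem_trigPoly {n : ℕ} {f : ℝ → ℝ} (hf : f ∈ trigPoly n) :
    (fun t => f t * Real.cos t) ∈ trigPoly (n + 1) := by
  induction hf using Submodule.span_induction with
  | mem f hf =>
    obtain ⟨k, hk, rfl | rfl⟩ := hf
    · have h1 := cos_int_mem_trigPoly (n := n + 1) (z := (k : ℤ) + 1) (by omega)
      have h2 := cos_int_mem_trigPoly (n := n + 1) (z := (k : ℤ) - 1) (by omega)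
      convert (trigPoly (n + 1)).smul_mem (1 / 2 : ℝ) ((trigPoly (n + 1)).add_mem h1 h2) using 1
      ext t
      simp only [Pi.smul_apply, Pi.add_apply, smul_eq_mul]
      push_cast
      rw [add_mul, sub_mul, one_mul, Real.cos_add, Real.cos_sub]
      ring
    · have h1 := sin_int_mem_trigPoly (n := n + 1) (z := (k : ℤ) + 1) (by omega)
      have h2 := sin_int_mem_trigPoly (n := n + 1) (z := (k : ℤ) - 1) (by omega)
      convert (trigPoly (n + 1)).smul_mem (1 / 2 : ℝ) ((trigPoly (n + 1)).add_mem h1 h2) using 1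
      ext t
      simp only [Pi.smul_apply, Pi.add_apply, smul_eq_mul]
      push_cast
      rw [add_mul, sub_mul, one_mul, Real.sin_add, Real.sin_sub]
      ring
  | zero =>
    convert (trigPoly (n + 1)).zero_mem using 1
    ext t
    simp
  | add f g _ _ hf hg =>
    convert (trigPoly (n + 1)).add_mem hf hg using 1
    ext t
    simp [add_mul]
  | smul c f _ hf =>
    convert (trigPoly (n + 1)).smul_mem c hf using 1
    ext t
    simp [mul_assoc]

theorem periodic_of_mem_trigPoly {n : ℕ} {f : ℝ → ℝ} (hf : f ∈ trigPoly n) :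
    Function.Periodic f (2 * π) := by
  induction hf using Submodule.span_induction with
  | mem f hf =>
    obtain ⟨k, hk, rfl | rfl⟩ := hf
    · intro t
      simp [mul_add]
    · intro t
      simp [mul_add]
  | zero => intro t; rfl
  | add f g _ _ hf hg => exact hf.add hg
  | smul c f _ hf => intro t; simp [hf t]

theorem exists_antideriv_of_mem_trigPoly {n : ℕ} {f : ℝ → ℝ} (hf : f ∈ trigPoly n) :
    ∃ c : ℝ, ∃ F ∈ trigPoly n, ∀ t, HasDerivAt F (f t - c) t := by
  induction hf using Submodule.span_induction with
  | mem f hf =>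
    obtain ⟨k, hk, h⟩ := hf
    rcases Nat.eq_zero_or_pos k with h0 | h0
    · subst h0
      rcases h with rfl | rfl
      · exact ⟨1, 0, Submodule.zero_mem _, fun t => by simp [hasDerivAt_zero]⟩
      · exact ⟨0, 0, Submodule.zero_mem _, fun t => by simp [hasDerivAt_zero]⟩
    · have hk0 : (k : ℝ) ≠ 0 := by positivity
      rcases h with rfl | rfl
      · refine ⟨0, _, (trigPoly n).smul_mem ((k : ℝ)⁻¹) (sin_nat_mem_trigPoly hk), fun t => ?_⟩
        have h1 : HasDerivAt (fun t : ℝ => (k : ℝ) * t) k t := by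
          simpa using (hasDerivAt_id t).const_mul (k : ℝ)
        refine (h1.sin.const_smul ((k : ℝ)⁻¹)).congr_deriv ?_
        simp only [smul_eq_mul]
        field_simp
        ring
      · refine ⟨0, _, (trigPoly n).smul_mem (-(k : ℝ)⁻¹) (cos_nat_mem_trigPoly hk), fun t => ?_⟩
        have h1 : HasDerivAt (fun t : ℝ => (k : ℝ) * t) k t := by
          simpa using (hasDerivAt_id t).const_mul (k : ℝ)
        refine (h1.cos.const_smul (-(k : ℝ)⁻¹)).congr_deriv ?_
        simp only [smul_eq_mul]
        field_simp
        ring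
  | zero => exact ⟨0, 0, Submodule.zero_mem _, fun t => by simp [hasDerivAt_zero]⟩
  | add f g _ _ hf hg =>
    obtain ⟨c, F, hF, hF'⟩ := hf
    obtain ⟨d, G, hG, hG'⟩ := hg
    refine ⟨c + d, F + G, Submodule.add_mem _ hF hG, fun t => ?_⟩
    refine ((hF' t).add (hG' t)).congr_deriv ?_
    change _ = f t + g t - (c + d)
    ring
  | smul r f _ hf =>
    obtain ⟨c, F, hF, hF'⟩ := hf
    refine ⟨r * c, r • F, Submodule.smul_mem _ _ hF, fun t => ?_⟩
    refine ((hF' t).const_smul r).congr_deriv ?_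
    change r * (f t - c) = r * f t - r * c
    ring

/-- The even part of a trigonometric polynomial is a polynomial in the cosine. -/
theorem exists_polynomial_even_part {n : ℕ} {f : ℝ → ℝ} (hf : f ∈ trigPoly n) :
    ∃ P : Polynomial ℝ, P.natDegree ≤ n ∧
      ∀ t, (f t + f (-t)) / 2 = P.eval (Real.cos t) := by
  induction hf using Submodule.span_induction with
  | mem f hf =>
    obtain ⟨k, hk, rfl | rfl⟩ := hf
    · refine ⟨Polynomial.Chebyshev.T ℝ k, ?_, fun t => ?_⟩
      · simpa using hk
      · rw [Polynomial.Chebyshev.T_real_cos]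
        simp
    · exact ⟨0, by simp, fun t => by simp⟩
  | zero => exact ⟨0, by simp, fun t => by simp⟩
  | add f g _ _ hf hg =>
    obtain ⟨P, hP, hP'⟩ := hf
    obtain ⟨Q, hQ, hQ'⟩ := hg
    refine ⟨P + Q, (Polynomial.natDegree_add_le _ _).trans (max_le hP hQ), fun t => ?_⟩
    rw [Polynomial.eval_add, ← hP', ← hQ']
    change (f t + g t + (f (-t) + g (-t))) / 2 = _
    ring
  | smul r f _ hf =>
    obtain ⟨P, hP, hP'⟩ := hf
    refine ⟨r • P, (Polynomial.natDegree_smul_le _ _).trans hP, fun t => ?_⟩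
    rw [Polynomial.eval_smul, ← hP']
    change (r * f t + r * f (-t)) / 2 = r * ((f t + f (-t)) / 2)
    ring

/-- The unnormalized Fejér–Korovkin kernel with nodal frequency `θ`. -/
noncomputable def fejerKorovkin (m : ℕ) (θ s : ℝ) : ℝ :=
  ∑ j ∈ Icc 1 (m + 1), ∑ k ∈ Icc 1 (m + 1),
    Real.sin (j * θ) * Real.sin (k * θ) * Real.cos (((j : ℤ) - k : ℤ) * s)

theorem fejerKorovkin_nonneg (m : ℕ) (θ s : ℝ) : 0 ≤ fejerKorovkin m θ s := by
  have : fejerKorovkin m θ s =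
      (∑ j ∈ Icc 1 (m + 1), Real.sin (j * θ) * Real.cos (j * s)) ^ 2 +
      (∑ j ∈ Icc 1 (m + 1), Real.sin (j * θ) * Real.sin (j * s)) ^ 2 := by
    rw [sq, sq, sum_mul_sum, sum_mul_sum, ← sum_add_distrib]
    refine sum_congr rfl fun j _ => ?_
    rw [← sum_add_distrib]
    refine sum_congr rfl fun k _ => ?_
    push_cast
    rw [sub_mul, Real.cos_sub]
    ring
  rw [this]
  positivity

theorem continuous_fejerKorovkin (m : ℕ) (θ : ℝ) : Continuous (fejerKorovkin m θ) := by
  unfold fejerKorovkin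
  fun_prop

theorem fejerKorovkin_periodic (m : ℕ) (θ : ℝ) :
    Function.Periodic (fejerKorovkin m θ) (2 * π) := by
  intro s
  unfold fejerKorovkin
  refine sum_congr rfl fun j _ => sum_congr rfl fun k _ => ?_
  rw [mul_add, Real.cos_add_int_mul_two_pi]

theorem integral_cos_int_mul (z : ℤ) :
    ∫ s in (-π)..π, Real.cos (z * s) = if z = 0 then 2 * π else 0 := by
  split_ifs with h
  · subst h
    simp
    ring
  · have hz : (z : ℝ) ≠ 0 := by exact_mod_cast h
    rw [intervalIntegral.integral_comp_mul_left (fun x => Real.cos x) hz]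
    simp [Real.sin_int_mul_pi]

theorem integral_fejerKorovkin (m : ℕ) (θ : ℝ) :
    ∫ s in (-π)..π, fejerKorovkin m θ s =
      2 * π * ∑ j ∈ Icc 1 (m + 1), Real.sin (j * θ) ^ 2 := by
  unfold fejerKorovkin
  rw [intervalIntegral.integral_finsetSum
    fun j _ => Continuous.intervalIntegrable (by fun_prop) _ _, mul_sum]
  refine sum_congr rfl fun j hj => ?_
  rw [intervalIntegral.integral_finsetSum
    fun j _ => Continuous.intervalIntegrable (by fun_prop) _ _]
  simp_rw [intervalIntegral.integral_const_mul, integral_cos_int_mul, sub_eq_zero, Nat.cast_inj]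
  simp only [mul_ite, mul_zero, sum_ite_eq, hj, if_true]
  ring

theorem integral_fejerKorovkin_mul_cos (m : ℕ) (θ : ℝ) (hθ : θ = π / (m + 2)) :
    ∫ s in (-π)..π, fejerKorovkin m θ s * Real.cos s =
      Real.cos θ * ∫ s in (-π)..π, fejerKorovkin m θ s := by
  rw [integral_fejerKorovkin]
  unfold fejerKorovkin
  simp_rw [sum_mul]
  rw [intervalIntegral.integral_finsetSum
    fun j _ => Continuous.intervalIntegrable (by fun_prop) _ _, mul_sum, mul_sum]
  refine sum_congr rfl fun j hj => ?_
  rw [intervalIntegral.integral_finsetSum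
    fun j _ => Continuous.intervalIntegrable (by fun_prop) _ _]
  have key : ∀ k : ℕ, ∫ s in (-π)..π, Real.sin (j * θ) * Real.sin (k * θ) *
      Real.cos (((j : ℤ) - k : ℤ) * s) * Real.cos s =
      (if k = j + 1 then π * Real.sin (j * θ) * Real.sin (k * θ) else 0) +
      (if k = j - 1 then π * Real.sin (j * θ) * Real.sin (k * θ) else 0) := by
    intro k
    have h1 : ∀ s : ℝ, Real.sin (j * θ) * Real.sin (k * θ) *
      Real.cos (((j : ℤ) - k : ℤ) * s) * Real.cos s =
      Real.sin (j * θ) * Real.sin (k * θ) / 2 *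
        (Real.cos (((j : ℤ) - k + 1 : ℤ) * s) + Real.cos (((j : ℤ) - k - 1 : ℤ) * s)) := by
      intro s
      push_cast
      rw [show ((j : ℝ) - k + 1) * s = (j - k) * s + s by ring,
        show ((j : ℝ) - k - 1) * s = (j - k) * s - s by ring, Real.cos_add, Real.cos_sub]
      ring
    simp_rw [h1]
    rw [intervalIntegral.integral_const_mul, intervalIntegral.integral_add
      (Continuous.intervalIntegrable (by fun_prop) _ _)
      (Continuous.intervalIntegrable (by fun_prop) _ _),
      integral_cos_int_mul, integral_cos_int_mul]
    have hj1 : 1 ≤ j := (mem_Icc.1 hj).1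
    have e1 : ((j : ℤ) - k + 1 = 0) ↔ k = j + 1 := by omega
    have e2 : ((j : ℤ) - k - 1 = 0) ↔ k = j - 1 := by omega
    simp only [e1, e2]
    split_ifs <;> ring
  simp_rw [key]
  rw [sum_add_distrib, sum_ite_eq', sum_ite_eq']
  have hj' := mem_Icc.1 hj
  have hm : ((m : ℝ) + 2) ≠ 0 := by positivity
  have a1 : (if j + 1 ∈ Icc 1 (m + 1) then
      π * Real.sin (j * θ) * Real.sin (((j + 1 : ℕ) : ℝ) * θ) else 0) =
      π * Real.sin (j * θ) * Real.sin (j * θ + θ) := by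
    have e : ((j + 1 : ℕ) : ℝ) * θ = j * θ + θ := by push_cast; ring
    rw [e]
    split_ifs with h
    · rfl
    · have hjm : j = m + 1 := by
        rw [mem_Icc] at h
        omega
      have : (j : ℝ) * θ + θ = π := by
        rw [hjm, hθ]
        push_cast
        field_simp
        ring
      rw [this, Real.sin_pi, mul_zero]
  have a2 : (if j - 1 ∈ Icc 1 (m + 1) then
      π * Real.sin (j * θ) * Real.sin (((j - 1 : ℕ) : ℝ) * θ) else 0) =
      π * Real.sin (j * θ) * Real.sin (j * θ - θ) := by
    have e : ((j - 1 : ℕ) : ℝ) * θ = j * θ - θ := by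
      rw [Nat.cast_sub hj'.1]
      push_cast
      ring
    rw [e]
    split_ifs with h
    · rfl
    · have hjm : j = 1 := by
        rw [mem_Icc] at h
        omega
      have : (j : ℝ) * θ - θ = 0 := by
        rw [hjm]
        push_cast
        ring
      rw [this, Real.sin_zero, mul_zero]
  rw [a1, a2, Real.sin_add, Real.sin_sub]
  ring

theorem integral_fejerKorovkin_pos (m : ℕ) :
    0 < ∫ s in (-π)..π, fejerKorovkin m (π / (m + 2)) s := by
  rw [integral_fejerKorovkin]
  have hm : (0 : ℝ) < m + 2 := by positivity
  refine mul_pos (mul_pos two_pos Real.pi_pos) (sum_pos (fun j hj => ?_) ⟨1, by simp⟩)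
  have hj' := mem_Icc.1 hj
  have hj1 : (j : ℝ) < m + 2 := by exact_mod_cast (show j < m + 2 by omega)
  have hj0 : (0 : ℝ) < j := by exact_mod_cast hj'.1
  refine pow_pos (Real.sin_pos_of_pos_of_lt_pi (mul_pos hj0 (div_pos Real.pi_pos hm)) ?_) 2
  rw [mul_div_assoc', div_lt_iff₀ hm, mul_comm]
  exact mul_lt_mul_of_pos_left hj1 Real.pi_pos

theorem convolution_mem_trigPoly {m : ℕ} {θ : ℝ} {g : ℝ → ℝ} (hg : Continuous g) :
    (fun t => ∫ s in (-π)..π, g s * fejerKorovkin m θ (t - s)) ∈ trigPoly m := by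
  have h : (fun t => ∫ s in (-π)..π, g s * fejerKorovkin m θ (t - s)) =
      ∑ j ∈ Icc 1 (m + 1), ∑ k ∈ Icc 1 (m + 1),
        ((Real.sin (j * θ) * Real.sin (k * θ) *
          ∫ s in (-π)..π, g s * Real.cos (((j : ℤ) - k : ℤ) * s)) •
            (fun t : ℝ => Real.cos (((j : ℤ) - k : ℤ) * t)) +
        (Real.sin (j * θ) * Real.sin (k * θ) *
          ∫ s in (-π)..π, g s * Real.sin (((j : ℤ) - k : ℤ) * s)) •
            (fun t : ℝ => Real.sin (((j : ℤ) - k : ℤ) * t))) := by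
    ext t
    simp only [Finset.sum_apply, Pi.add_apply, Pi.smul_apply, smul_eq_mul]
    unfold fejerKorovkin
    simp_rw [mul_sum]
    rw [intervalIntegral.integral_finsetSum
      fun j _ => Continuous.intervalIntegrable (by fun_prop) _ _]
    refine sum_congr rfl fun j _ => ?_
    rw [intervalIntegral.integral_finsetSum
      fun j _ => Continuous.intervalIntegrable (by fun_prop) _ _]
    refine sum_congr rfl fun k _ => ?_
    rw [mul_assoc (Real.sin (j * θ) * Real.sin (k * θ)),
      mul_assoc (Real.sin (j * θ) * Real.sin (k * θ)), ← intervalIntegral.integral_mul_const,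
      ← intervalIntegral.integral_mul_const, ← mul_add, ← intervalIntegral.integral_add
      (Continuous.intervalIntegrable (by fun_prop) _ _)
      (Continuous.intervalIntegrable (by fun_prop) _ _), ← intervalIntegral.integral_const_mul]
    congr 1
    ext s
    rw [mul_sub, Real.cos_sub]
    ring
  rw [h]
  refine Submodule.sum_mem _ fun j hj => Submodule.sum_mem _ fun k hk => ?_
  have hj' := mem_Icc.1 hj
  have hk' := mem_Icc.1 hk
  exact Submodule.add_mem _ (Submodule.smul_mem _ _ (cos_int_mem_trigPoly (by omega)))
    (Submodule.smul_mem _ _ (sin_int_mem_trigPoly (by omega)))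

/-- Jackson's theorem for Lipschitz periodic functions. -/
theorem exists_trigPoly_of_lipschitz (m : ℕ) {g : ℝ → ℝ} {M : ℝ}
    (hper : Function.Periodic g (2 * π)) (hM : ∀ s t, |g s - g t| ≤ M * |s - t|) :
    ∃ T ∈ trigPoly m, ∀ t, |g t - T t| ≤ 13 * M / (m + 1) := by
  have hM0 : 0 ≤ M := by
    have := (abs_nonneg _).trans (hM 1 0)
    simpa using this
  have hgc : Continuous g := by
    have : LipschitzWith ⟨M, hM0⟩ g := by
      apply LipschitzWith.of_dist_le_mul
      intro x y
      exact hM x y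
    exact this.continuous
  set θ : ℝ := π / (m + 2) with hθ
  set J := fejerKorovkin m θ with hJ
  have hJc : Continuous J := continuous_fejerKorovkin m θ
  set N := ∫ s in (-π)..π, J s with hN
  have hN0 : 0 < N := integral_fejerKorovkin_pos m
  refine ⟨_, (trigPoly m).smul_mem N⁻¹ (convolution_mem_trigPoly (θ := θ) hgc), fun t => ?_⟩
  have hshift : ∫ s in (-π)..π, g s * J (t - s) = ∫ s in (-π)..π, g (t - s) * J s := by
    have hp : Function.Periodic (fun s => g (t - s) * J s) (2 * π) := by
      intro s
      have h1 : g (t - (s + 2 * π)) = g (t - s) := by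
        rw [← sub_sub]; exact hper.sub_eq _
      simp only [h1, fejerKorovkin_periodic m θ s, hJ]
    have h2 := intervalIntegral.integral_comp_sub_left (a := -π) (b := π)
      (fun s => g (t - s) * J s) t
    simp only [sub_sub_cancel] at h2
    rw [h2]
    have h3 := hp.intervalIntegral_add_eq (t - π) (-π)
    rw [show t - π + 2 * π = t - -π by ring, show -π + 2 * π = π by ring] at h3
    exact h3
  have hdiff : g t * N - ∫ s in (-π)..π, g s * J (t - s) =
      ∫ s in (-π)..π, (g t - g (t - s)) * J s := by
    rw [hshift, hN, ← intervalIntegral.integral_const_mul, ← intervalIntegral.integral_sub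
      (Continuous.intervalIntegrable (by fun_prop) _ _)
      (Continuous.intervalIntegrable (by fun_prop) _ _)]
    congr 1
    ext s
    ring
  have hm1 : (0 : ℝ) < (m : ℝ) + 1 := by positivity
  set ε : ℝ := 1 / ((m : ℝ) + 1) with hε
  have hε0 : 0 < ε := by positivity
  have hbound : |∫ s in (-π)..π, (g t - g (t - s)) * J s| ≤
      ∫ s in (-π)..π, (M * (ε / 2) * J s + M * (π ^ 2 / (4 * ε)) * (J s - J s * Real.cos s)) := by
    rw [← Real.norm_eq_abs]
    apply intervalIntegral.norm_integral_le_of_norm_le (by linarith [Real.pi_pos])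
    · refine Filter.Eventually.of_forall fun s hs => ?_
      have hJs : 0 ≤ J s := fejerKorovkin_nonneg m θ s
      rw [Real.norm_eq_abs, abs_mul, abs_of_nonneg hJs]
      have h1 : |g t - g (t - s)| ≤ M * |s| := by simpa using hM t (t - s)
      have hs' : |s| ≤ π := abs_le.2 ⟨hs.1.le, hs.2⟩
      have h2 := Real.cos_le_one_sub_mul_cos_sq hs'
      have h3 : s ^ 2 ≤ π ^ 2 / 2 * (1 - Real.cos s) := by
        have hp2 : 0 < π ^ 2 := by positivity
        have h4 : 2 / π ^ 2 * s ^ 2 ≤ 1 - Real.cos s := by linarith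
        calc s ^ 2 = π ^ 2 / 2 * (2 / π ^ 2 * s ^ 2) := by field_simp
          _ ≤ _ := by gcongr
      have h5 : |s| ≤ ε / 2 + π ^ 2 / (4 * ε) * (1 - Real.cos s) := by
        have h6 : |s| ≤ ε / 2 + s ^ 2 / (2 * ε) := by
          rw [div_add_div _ _ (by norm_num) (by positivity), le_div_iff₀ (by positivity)]
          nlinarith [sq_nonneg (|s| - ε), sq_abs s]
        have h7 : s ^ 2 / (2 * ε) ≤ (π ^ 2 / 2 * (1 - Real.cos s)) / (2 * ε) := by gcongr
        have h8 : (π ^ 2 / 2 * (1 - Real.cos s)) / (2 * ε) =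
          π ^ 2 / (4 * ε) * (1 - Real.cos s) := by
          field_simp
          ring
        linarith
      calc |g t - g (t - s)| * J s
          ≤ (M * (ε / 2 + π ^ 2 / (4 * ε) * (1 - Real.cos s))) * J s := by
            gcongr
            exact h1.trans (by gcongr)
        _ = _ := by ring
    · exact Continuous.intervalIntegrable (by fun_prop) _ _
  have hval : ∫ s in (-π)..π,
      (M * (ε / 2) * J s + M * (π ^ 2 / (4 * ε)) * (J s - J s * Real.cos s)) =
      M * (ε / 2) * N + M * (π ^ 2 / (4 * ε)) * (N - Real.cos θ * N) := by
    rw [intervalIntegral.integral_add (Continuous.intervalIntegrable (by fun_prop) _ _)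
      (Continuous.intervalIntegrable (by fun_prop) _ _), intervalIntegral.integral_const_mul,
      intervalIntegral.integral_const_mul, intervalIntegral.integral_sub
      (Continuous.intervalIntegrable (by fun_prop) _ _)
      (Continuous.intervalIntegrable (by fun_prop) _ _),
      integral_fejerKorovkin_mul_cos m θ hθ]
  have hcos : 1 - Real.cos θ ≤ ε ^ 2 * (π ^ 2 / 2) := by
    have h1 := Real.one_sub_sq_div_two_le_cos (x := θ)
    have h2 : θ ^ 2 ≤ (π * ε) ^ 2 := by
      have : θ ≤ π * ε := by
        rw [hθ, hε, mul_one_div]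
        have := Real.pi_pos
        gcongr
        norm_num
      have : 0 ≤ θ := by have := Real.pi_pos; positivity
      gcongr
    nlinarith
  have hfin : M * (ε / 2) * N + M * (π ^ 2 / (4 * ε)) * (N - Real.cos θ * N) ≤ 13 * M * ε * N := by
    have h1 : M * (π ^ 2 / (4 * ε)) * (N - Real.cos θ * N) ≤
        M * (π ^ 2 / (4 * ε)) * (N * (ε ^ 2 * (π ^ 2 / 2))) := by
      rw [show N - Real.cos θ * N = N * (1 - Real.cos θ) by ring]
      gcongr
    have h2 : M * (π ^ 2 / (4 * ε)) * (N * (ε ^ 2 * (π ^ 2 / 2))) = M * ε * N * (π ^ 4 / 8) := by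
      field_simp
      ring
    have h3 : π ^ 4 / 8 ≤ 12.5 := by
      have h4 : π ^ 4 ≤ 3.15 ^ 4 := by
        have := Real.pi_lt_d2
        have := Real.pi_pos
        gcongr
      norm_num at h4 ⊢
      linarith
    have h5 : M * ε * N * (π ^ 4 / 8) ≤ M * ε * N * 12.5 := by gcongr
    linarith
  have htot : |g t * N - ∫ s in (-π)..π, g s * J (t - s)| ≤ 13 * M * ε * N := by
    rw [hdiff]
    exact hbound.trans (hval ▸ hfin)
  simp only [Pi.smul_apply, smul_eq_mul]
  have e1 : g t - N⁻¹ * ∫ s in (-π)..π, g s * J (t - s) =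
      (g t * N - ∫ s in (-π)..π, g s * J (t - s)) / N := by
    field_simp
  rw [e1, abs_div, abs_of_pos hN0, div_le_iff₀ hN0]
  calc _ ≤ _ := htot
    _ = _ := by rw [hε]; ring

theorem exists_trigPoly_of_hasDerivAt (m : ℕ) {g g' : ℝ → ℝ} {M : ℝ}
    (hper : Function.Periodic g (2 * π)) (hg : ∀ t, HasDerivAt g (g' t) t)
    (hM : ∀ t, |g' t| ≤ M) :
    ∃ T ∈ trigPoly m, ∀ t, |g t - T t| ≤ 13 * M / (m + 1) := by
  refine exists_trigPoly_of_lipschitz m hper fun s t => ?_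
  have := Convex.norm_image_sub_le_of_norm_hasDerivWithin_le (f := g) (f' := g') (s := Set.univ)
    (x := t) (y := s) (C := M) (fun x _ => (hg x).hasDerivWithinAt) (fun x _ => hM x)
    convex_univ trivial trivial
  simpa using this

/-- Favard-type step: an approximation of the derivative improves by a factor `1 / m`. -/
theorem exists_trigPoly_of_deriv_approx (m : ℕ) {g g' q : ℝ → ℝ} {E : ℝ}
    (hper : Function.Periodic g (2 * π)) (hg : ∀ t, HasDerivAt g (g' t) t)
    (hq : q ∈ trigPoly m) (hE : ∀ t, |g' t - q t| ≤ E) :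
    ∃ T ∈ trigPoly m, ∀ t, |g t - T t| ≤ 26 * E / (m + 1) := by
  obtain ⟨c, Q, hQ, hQ'⟩ := exists_antideriv_of_mem_trigPoly hq
  have hd : ∀ t, HasDerivAt (fun t => g t - Q t) (g' t - (q t - c)) t :=
    fun t => (hg t).sub (hQ' t)
  have hp : Function.Periodic (fun t => g t - Q t) (2 * π) :=
    fun t => by simp only [hper t, periodic_of_mem_trigPoly hQ t]
  have hc : |c| ≤ E := by
    obtain ⟨ξ, _, hξ⟩ := exists_hasDerivAt_eq_zero (f := fun t => g t - Q t)
      (f' := fun t => g' t - (q t - c)) (a := 0) (b := 2 * π) (by positivity)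
      (fun t _ => (hd t).continuousAt.continuousWithinAt)
      (by have := hp 0; rw [zero_add] at this; exact this.symm) (fun t _ => hd t)
    have h := hE ξ
    rw [show g' ξ - q ξ = -c by linarith, abs_neg] at h
    exact h
  obtain ⟨T, hT, hT'⟩ := exists_trigPoly_of_hasDerivAt m (M := 2 * E) hp hd fun t => by
    rw [show g' t - (q t - c) = (g' t - q t) + c by ring]
    linarith [abs_add_le (g' t - q t) c, hE t]
  refine ⟨Q + T, Submodule.add_mem _ hQ hT, fun t => ?_⟩
  calc |g t - (Q + T) t| = |g t - Q t - T t| := by rw [Pi.add_apply, sub_sub]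
    _ ≤ _ := hT' t
    _ = _ := by ring

/-- Transfer of a trigonometric approximation of `t ↦ h (lam * (1 - cos t) / 2)` to an algebraic
approximation of `h` on `[0, lam]`. -/
theorem exists_polynomial_of_trigPoly {n : ℕ} {h T : ℝ → ℝ} {lam E : ℝ} (hlam : 0 < lam)
    (hT : T ∈ trigPoly n) (hE : ∀ t, |h (lam * (1 - Real.cos t) / 2) - T t| ≤ E) :
    ∃ P : Polynomial ℝ, P.natDegree ≤ n ∧ ∀ x ∈ Set.Icc 0 lam, |h x - P.eval x| ≤ E := by
  obtain ⟨P, hP, hP'⟩ := exists_polynomial_even_part hT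
  refine ⟨P.comp (Polynomial.C 1 - Polynomial.C (2 / lam) * Polynomial.X), ?_, fun x hx => ?_⟩
  · refine Polynomial.natDegree_comp_le.trans ?_
    have h1 : (Polynomial.C 1 - Polynomial.C (2 / lam) * Polynomial.X :
        Polynomial ℝ).natDegree ≤ 1 := by
      compute_degree
    calc _ ≤ P.natDegree * 1 := Nat.mul_le_mul_left _ h1
      _ ≤ n := by omega
  · have hx2 : 2 / lam * x ≤ 2 := by
      rw [div_mul_eq_mul_div, div_le_iff₀ hlam]
      linarith [hx.2]
    have hx0 : 0 ≤ 2 / lam * x := by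
      have := hx.1
      positivity
    have hcos : Real.cos (Real.arccos (1 - 2 / lam * x)) = 1 - 2 / lam * x :=
      Real.cos_arccos (by linarith) (by linarith)
    set t := Real.arccos (1 - 2 / lam * x)
    have hxt : lam * (1 - Real.cos t) / 2 = x := by
      rw [hcos]
      field_simp
      ring
    have h1 := hE t
    have h2 := hE (-t)
    rw [Real.cos_neg] at h2
    rw [hxt] at h1 h2
    have h3 : (P.comp (Polynomial.C 1 - Polynomial.C (2 / lam) * Polynomial.X)).eval x =
        (T t + T (-t)) / 2 := by
      rw [hP' t, hcos]
      simp
    rw [h3]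
    rw [abs_le] at h1 h2 ⊢
    constructor <;> linarith

theorem abs_sub_le_of_abs_deriv_le_rpow {F F' : ℝ → ℝ} {M β x y : ℝ} (hβ : β ≠ 0) (hx : 0 < x)
    (hxy : x ≤ y) (hF : ∀ s ∈ Set.Icc x y, HasDerivAt F (F' s) s)
    (hM : ∀ s ∈ Set.Icc x y, |F' s| ≤ M * s ^ (β - 1)) :
    |F y - F x| ≤ M / β * (y ^ β - x ^ β) := by
  have hpow : ∀ s ∈ Set.Icc x y, HasDerivAt (fun s : ℝ => M / β * s ^ β) (M * s ^ (β - 1)) s := by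
    intro s hs
    refine ((Real.hasDerivAt_rpow_const (Or.inl (hx.trans_le hs.1).ne')).const_mul
      (M / β)).congr_deriv ?_
    field_simp
  have hmono : ∀ (G G' : ℝ → ℝ), (∀ s ∈ Set.Icc x y, HasDerivAt G (G' s) s) →
      (∀ s ∈ Set.Icc x y, 0 ≤ G' s) → G x ≤ G y := by
    intro G G' hG hG'
    have : MonotoneOn G (Set.Icc x y) := by
      refine monotoneOn_of_hasDerivWithinAt_nonneg (convex_Icc x y)
        (fun s hs => (hG s hs).continuousAt.continuousWithinAt)
        (fun s hs => (hG s (interior_subset hs)).hasDerivWithinAt)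
        (fun s hs => hG' s (interior_subset hs))
    exact this (Set.left_mem_Icc.2 hxy) (Set.right_mem_Icc.2 hxy) hxy
  have h1 := hmono _ _ (fun s hs => (hpow s hs).sub (hF s hs))
    (fun s hs => by have := (abs_le.1 (hM s hs)).2; linarith)
  have h2 := hmono _ _ (fun s hs => (hpow s hs).add (hF s hs))
    (fun s hs => by have := (abs_le.1 (hM s hs)).1; linarith)
  simp only [Pi.sub_apply, Pi.add_apply] at h1 h2
  rw [abs_le]
  constructor <;> linarith

theorem exists_primitive_eqOn {F F' H : ℝ → ℝ} {a b : ℝ}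
    (hF : ∀ p ∈ Set.Icc a b, HasDerivAt F (F' p) p) (hc : Continuous H)
    (hH : ∀ x ∈ Set.Icc a b, H x = F' x) :
    ∃ G : ℝ → ℝ, (∀ x, HasDerivAt G (H x) x) ∧ ∀ x ∈ Set.Icc a b, G x = F x := by
  refine ⟨fun x => F b + ∫ s in b..x, H s, fun x => ?_, fun x hx => ?_⟩
  · exact (intervalIntegral.integral_hasDerivAt_right (hc.intervalIntegrable _ _)
      (hc.stronglyMeasurableAtFilter _ _) hc.continuousAt).const_add _
  · have : ∫ s in b..x, H s = F x - F b := by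
      refine intervalIntegral.integral_eq_sub_of_hasDerivAt (fun s hs => ?_)
        (hc.intervalIntegrable _ _)
      rw [Set.uIcc_of_ge hx.2] at hs
      have hs' : s ∈ Set.Icc a b := ⟨hx.1.trans hs.1, hs.2⟩
      rw [hH s hs']
      exact hF s hs'
    simp [this]

theorem continuous_comp_clamp {F : ℝ → ℝ} {a b : ℝ} (hab : a ≤ b)
    (hF : ContinuousOn F (Set.Icc a b)) : Continuous fun x => F (max a (min x b)) :=
  hF.comp_continuous (by fun_prop) fun _ => ⟨le_max_left _ _, max_le hab (min_le_right _ _)⟩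

theorem abs_le_at_zero {f : ℝ → ℝ} {b E : ℝ} (hb : 0 < b)
    (hf : ContinuousWithinAt f (Set.Icc 0 b) 0) (hE : ∀ x ∈ Set.Ioc 0 b, |f x| ≤ E) :
    |f 0| ≤ E := by
  have h1 : Filter.Tendsto (fun x => |f x|) (nhdsWithin 0 (Set.Ioc 0 b)) (nhds |f 0|) :=
    ((hf.mono Set.Ioc_subset_Icc_self).tendsto).abs
  have : (nhdsWithin (0 : ℝ) (Set.Ioc 0 b)).NeBot := by
    rw [← mem_closure_iff_nhdsWithin_neBot, closure_Ioc hb.ne]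
    exact ⟨le_rfl, hb.le⟩
  exact le_of_tendsto h1 (eventually_mem_nhdsWithin.mono hE)

theorem abs_sub_eval_le_of_comparison {φ h : ℝ → ℝ} {P : Polynomial ℝ} {lam E₁ E₂ : ℝ}
    (hlam : 0 < lam) (hφ : ContinuousWithinAt φ (Set.Icc 0 lam) 0) (hh : Continuous h)
    (h₁ : ∀ x ∈ Set.Ioc 0 lam, |φ x - h x| ≤ E₁) (h₂ : ∀ x ∈ Set.Icc 0 lam, |h x - P.eval x| ≤ E₂) :
    ∀ x ∈ Set.Icc 0 lam, |φ x - P.eval x| ≤ E₁ + E₂ := by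
  intro x hx
  have h3 : |φ x - h x| ≤ E₁ := by
    rcases hx.1.eq_or_lt with h0 | h0
    · rw [← h0]
      exact abs_le_at_zero hlam (hφ.sub hh.continuousWithinAt) h₁
    · exact h₁ x ⟨h0, hx.2⟩
  exact (abs_sub_le _ (h x) _).trans (add_le_add h3 (h₂ x hx))

theorem rpow_mul_rpow_le {a y p q : ℝ} (ha : 0 < a) (hy : a ≤ y) (hpq : p + q ≤ 0) :
    y ^ p * y ^ q ≤ a ^ (p + q) := by
  rw [← Real.rpow_add (ha.trans_le hy)]
  exact Real.rpow_le_rpow_of_nonpos ha hy hpq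

section HalfAngle

variable (lam t : ℝ)

theorem hasDerivAt_halfAngle :
    HasDerivAt (fun t => lam * (1 - Real.cos t) / 2) (lam * Real.sin t / 2) t := by
  refine ((((Real.hasDerivAt_cos t).const_sub 1).const_mul lam).div_const 2).congr_deriv ?_
  ring

theorem hasDerivAt_halfAngle_deriv :
    HasDerivAt (fun t => lam * Real.sin t / 2) (lam * Real.cos t / 2) t :=
  ((Real.hasDerivAt_sin t).const_mul lam).div_const 2

theorem hasDerivAt_halfAngle_deriv_two :
    HasDerivAt (fun t => lam * Real.cos t / 2) (-(lam * Real.sin t / 2)) t := by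
  refine (((Real.hasDerivAt_cos t).const_mul lam).div_const 2).congr_deriv ?_
  ring

theorem halfAngle_mem (hlam : 0 ≤ lam) : lam * (1 - Real.cos t) / 2 ∈ Set.Icc 0 lam := by
  have h1 := Real.cos_le_one t
  have h2 := Real.neg_one_le_cos t
  constructor
  · have : 0 ≤ 1 - Real.cos t := by linarith
    positivity
  · nlinarith

theorem abs_halfAngle_deriv_le {a L : ℝ} (ha : 0 < a) (hL : 0 ≤ L) (hlam : lam = L ^ 2 * a) :
    |lam * Real.sin t / 2| ≤
      L * a ^ (1 / 2 : ℝ) * (max a (lam * (1 - Real.cos t) / 2)) ^ (1 / 2 : ℝ) := by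
  have hlam0 : 0 ≤ lam := by rw [hlam]; positivity
  have hm : 0 ≤ max a (lam * (1 - Real.cos t) / 2) := ha.le.trans (le_max_left _ _)
  rw [← Real.sqrt_eq_rpow, ← Real.sqrt_eq_rpow]
  refine abs_le_of_sq_le_sq ?_ (by positivity)
  rw [mul_pow, mul_pow, Real.sq_sqrt ha.le, Real.sq_sqrt hm, ← hlam]
  have h1 : (lam * Real.sin t / 2) ^ 2 =
      lam * (lam * (1 - Real.cos t) / 2) * ((1 + Real.cos t) / 2) := by
    have := Real.sin_sq t
    linear_combination (lam ^ 2 / 4) * this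
  have h2 := halfAngle_mem lam t hlam0
  calc _ = _ := h1
    _ ≤ lam * (lam * (1 - Real.cos t) / 2) * 1 := by
      apply mul_le_mul_of_nonneg_left
      · linarith [Real.cos_le_one t]
      · exact mul_nonneg hlam0 h2.1
    _ ≤ _ := by
      rw [mul_one]
      exact mul_le_mul_of_nonneg_left (le_max_right _ _) hlam0

theorem periodic_comp_halfAngle (h : ℝ → ℝ) :
    Function.Periodic (fun t => h (lam * (1 - Real.cos t) / 2)) (2 * π) := by
  intro t
  simp only [Real.cos_add_two_pi]

end HalfAngle

/-- Approximation on `[0, lam]` from a trigonometric approximation of the second derivative in the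
angle variable. -/
theorem exists_polynomial_of_second_deriv_approx {L : ℕ} {h₀ h₁ h₂ q : ℝ → ℝ} {lam E : ℝ}
    (hL : 1 ≤ L) (hlam : 0 < lam) (hd₀ : ∀ x, HasDerivAt h₀ (h₁ x) x) (hd₁ : ∀ x, HasDerivAt h₁ (h₂ x) x)
    (hq : q ∈ trigPoly L)
    (hE : ∀ t, |h₂ (lam * (1 - Real.cos t) / 2) * (lam * Real.sin t / 2) ^ 2 +
      h₁ (lam * (1 - Real.cos t) / 2) * (lam * Real.cos t / 2) - q t| ≤ E * L ^ 2) :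
    ∃ P : Polynomial ℝ, P.natDegree ≤ L ∧
      ∀ x ∈ Set.Icc 0 lam, |h₀ x - P.eval x| ≤ 676 * E := by
  have hx := hasDerivAt_halfAngle lam
  have d1 : ∀ t, HasDerivAt (fun t => h₀ (lam * (1 - Real.cos t) / 2))
      (h₁ (lam * (1 - Real.cos t) / 2) * (lam * Real.sin t / 2)) t :=
    fun t => (hd₀ _).comp t (hx t)
  have d2 : ∀ t, HasDerivAt (fun t => h₁ (lam * (1 - Real.cos t) / 2) * (lam * Real.sin t / 2))
      (h₂ (lam * (1 - Real.cos t) / 2) * (lam * Real.sin t / 2) ^ 2 +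
      h₁ (lam * (1 - Real.cos t) / 2) * (lam * Real.cos t / 2)) t := fun t => by
    refine (((hd₁ _).comp t (hx t)).mul (hasDerivAt_halfAngle_deriv lam t)).congr_deriv ?_
    simp only [Function.comp_apply]
    ring
  obtain ⟨T₁, hT₁, hT₁'⟩ := exists_trigPoly_of_deriv_approx L
    (fun t => by simp only [Real.cos_add_two_pi, Real.sin_add_two_pi]) d2 hq hE
  obtain ⟨T₀, hT₀, hT₀'⟩ := exists_trigPoly_of_deriv_approx L
    (periodic_comp_halfAngle lam h₀) d1 hT₁ hT₁'
  refine exists_polynomial_of_trigPoly hlam hT₀ fun t => (hT₀' t).trans ?_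
  have hEL : 0 ≤ E * L ^ 2 := (abs_nonneg _).trans (hE 0)
  have h0 : (0 : ℝ) < L := by exact_mod_cast hL
  have hE0 : 0 ≤ E := nonneg_of_mul_nonneg_left hEL (by positivity)
  rw [div_le_iff₀ (by positivity), mul_div_assoc', div_le_iff₀ (by positivity)]
  have : (L : ℝ) ^ 2 ≤ (L + 1) * (L + 1) := by nlinarith
  calc 26 * (26 * (E * (L : ℝ) ^ 2)) = 676 * E * L ^ 2 := by ring
    _ ≤ 676 * E * ((L + 1) * (L + 1)) := by gcongr
    _ = _ := by ring

theorem abs_sub_le_of_abs_second_deriv_sub_le {φ ψ₁ ψ₂ h₀ h₁ h₂ : ℝ → ℝ} {α a M : ℝ}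
    (hα : α ∈ Set.Ioo (1 / 2 : ℝ) (3 / 2))
    (hφ : ∀ p ∈ Set.Ioc 0 a, HasDerivAt φ (ψ₁ p) p) (hψ : ∀ p ∈ Set.Ioc 0 a, HasDerivAt ψ₁ (ψ₂ p) p)
    (hd₀ : ∀ x, HasDerivAt h₀ (h₁ x) x) (hd₁ : ∀ x, HasDerivAt h₁ (h₂ x) x)
    (e₀ : h₀ a = φ a) (e₁ : h₁ a = ψ₁ a) (hM : 0 ≤ M)
    (hb : ∀ s ∈ Set.Ioc 0 a, |ψ₂ s - h₂ s| ≤ M * s ^ (α - 2)) :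
    ∀ x ∈ Set.Ioc 0 a, |φ x - h₀ x| ≤ M / (3 / 2 - α) / (α - 1 / 2) * a ^ α := by
  have hα1 := hα.1
  have hα2 : 0 < 3 / 2 - α := by linarith [hα.2]
  have hα3 : 0 < α - 1 / 2 := by linarith [hα.1]
  have step : ∀ x ∈ Set.Ioc 0 a, |ψ₁ x - h₁ x| ≤
      M * a ^ (1 / 2 : ℝ) / (3 / 2 - α) * x ^ (α - 1 / 2 - 1) := by
    intro x hx
    have ha : 0 < a := hx.1.trans_le hx.2
    have hsub : ∀ s ∈ Set.Icc x a, s ∈ Set.Ioc 0 a := fun s hs => ⟨hx.1.trans_le hs.1, hs.2⟩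
    have h1 := abs_sub_le_of_abs_deriv_le_rpow (F := fun s => ψ₁ s - h₁ s)
      (F' := fun s => ψ₂ s - h₂ s) (M := M * a ^ (1 / 2 : ℝ)) (β := α - 3 / 2)
      (by linarith) hx.1 hx.2 (fun s hs => (hψ s (hsub s hs)).sub (hd₁ s)) (fun s hs => by
        have hs0 : 0 < s := hx.1.trans_le hs.1
        refine (hb s (hsub s hs)).trans ?_
        rw [mul_assoc]
        refine mul_le_mul_of_nonneg_left ?_ hM
        rw [show α - 2 = 1 / 2 + (α - 3 / 2 - 1) by ring, Real.rpow_add hs0]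
        have := hs.2
        gcongr)
    simp only [e₁, sub_self, zero_sub, abs_neg] at h1
    refine h1.trans ?_
    rw [show α - 1 / 2 - 1 = α - 3 / 2 by ring, show M * a ^ (1 / 2 : ℝ) / (α - 3 / 2) =
      -(M * a ^ (1 / 2 : ℝ) / (3 / 2 - α)) by rw [← div_neg]; congr 1; ring, neg_mul, ← mul_neg]
    refine mul_le_mul_of_nonneg_left ?_ (by positivity)
    have : 0 < a ^ (α - 3 / 2) := by positivity
    linarith
  intro x hx
  have ha : 0 < a := hx.1.trans_le hx.2
  have hsub : ∀ s ∈ Set.Icc x a, s ∈ Set.Ioc 0 a := fun s hs => ⟨hx.1.trans_le hs.1, hs.2⟩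
  have h1 := abs_sub_le_of_abs_deriv_le_rpow (F := fun s => φ s - h₀ s)
    (F' := fun s => ψ₁ s - h₁ s) (M := M * a ^ (1 / 2 : ℝ) / (3 / 2 - α)) (β := α - 1 / 2)
    (by linarith) hx.1 hx.2 (fun s hs => (hφ s (hsub s hs)).sub (hd₀ s))
    (fun s hs => step s (hsub s hs))
  simp only [e₀, sub_self, zero_sub, abs_neg] at h1
  refine h1.trans ?_
  have h2 : a ^ α = a ^ (1 / 2 : ℝ) * a ^ (α - 1 / 2) := by
    rw [← Real.rpow_add ha]
    congr 1
    ring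
  have h3 : 0 < x ^ (α - 1 / 2) := Real.rpow_pos_of_pos hx.1 _
  calc _ ≤ M * a ^ (1 / 2 : ℝ) / (3 / 2 - α) / (α - 1 / 2) * a ^ (α - 1 / 2) := by
        refine mul_le_mul_of_nonneg_left ?_ (by positivity)
        linarith
    _ = _ := by rw [h2]; ring

theorem abs_comp_clamp_le {ψ : ℝ → ℝ} {K e a lam x : ℝ} (ha : 0 < a) (hal : a ≤ lam)
    (hb : ∀ p ∈ Set.Ioc 0 lam, |ψ p| ≤ K * p ^ e) (hx : x ≤ lam) :
    |ψ (max a (min x lam))| ≤ K * (max a x) ^ e := by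
  rw [min_eq_left hx]
  exact hb _ ⟨ha.trans_le (le_max_left _ _), max_le hal hx⟩

theorem comp_clamp_eq {ψ : ℝ → ℝ} {a lam x : ℝ} (hx : x ∈ Set.Icc a lam) :
    ψ (max a (min x lam)) = ψ x := by
  rw [min_eq_left hx.2, max_eq_right hx.1]

theorem le_sq_mul {L : ℕ} (hL : 1 ≤ L) {a : ℝ} (ha : 0 < a) : a ≤ (L : ℝ) ^ 2 * a := by
  have h1 : (1 : ℝ) ≤ L := by exact_mod_cast hL
  exact le_mul_of_one_le_left ha.le (one_le_pow₀ h1)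

theorem const_nonneg_of_bound {ψ : ℝ → ℝ} {K e lam : ℝ} (hlam : 0 < lam)
    (hb : ∀ p ∈ Set.Ioc 0 lam, |ψ p| ≤ K * p ^ e) : 0 ≤ K :=
  nonneg_of_mul_nonneg_left ((abs_nonneg _).trans (hb lam ⟨hlam, le_rfl⟩))
    (Real.rpow_pos_of_pos hlam _)

theorem exists_polynomial_of_first_deriv_bound {φ ψ₁ : ℝ → ℝ} {α K a lam : ℝ} {L : ℕ}
    (hα : α ∈ Set.Ioc (0 : ℝ) (1 / 2)) (hL : 1 ≤ L) (ha : 0 < a) (hlam : lam = (L : ℝ) ^ 2 * a)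
    (hφ0 : ContinuousWithinAt φ (Set.Icc 0 lam) 0)
    (hφ : ∀ p ∈ Set.Ioc 0 lam, HasDerivAt φ (ψ₁ p) p) (hc : ContinuousOn ψ₁ (Set.Ioc 0 lam))
    (hb : ∀ p ∈ Set.Ioc 0 lam, |ψ₁ p| ≤ K * p ^ (α - 1)) :
    ∃ P : Polynomial ℝ, P.natDegree ≤ L ∧
      ∀ x ∈ Set.Icc 0 lam, |φ x - P.eval x| ≤ (2 * K / α + 13 * K) * a ^ α := by
  have hal : a ≤ lam := hlam ▸ le_sq_mul hL ha
  have hlam0 : 0 < lam := ha.trans_le hal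
  have hK : 0 ≤ K := const_nonneg_of_bound hlam0 hb
  have hα0 := hα.1
  have hIcc : Set.Icc a lam ⊆ Set.Ioc 0 lam := fun x hx => ⟨ha.trans_le hx.1, hx.2⟩
  have hHc := continuous_comp_clamp hal (hc.mono hIcc)
  obtain ⟨h₀, hd₀, he₀⟩ := exists_primitive_eqOn (fun p hp => hφ p (hIcc hp)) hHc
    fun x hx => comp_clamp_eq hx
  have happ : ∀ t, |ψ₁ (max a (min (lam * (1 - Real.cos t) / 2) lam)) * (lam * Real.sin t / 2)| ≤
      K * a ^ α / a * (L * a) := fun t => by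
    have hx := halfAngle_mem lam t hlam0.le
    have h1 := abs_comp_clamp_le ha hal hb hx.2
    have h2 := abs_halfAngle_deriv_le lam t ha (Nat.cast_nonneg L) hlam
    set m := max a (lam * (1 - Real.cos t) / 2)
    have hm : a ≤ m := le_max_left _ _
    have hm0 := ha.trans_le hm
    have h3 := rpow_mul_rpow_le ha hm (p := α - 1) (q := 1 / 2) (by linarith [hα.2])
    rw [abs_mul]
    calc _ ≤ (K * m ^ (α - 1)) * (L * a ^ (1 / 2 : ℝ) * m ^ (1 / 2 : ℝ)) := by gcongr
      _ = K * L * a ^ (1 / 2 : ℝ) * (m ^ (α - 1) * m ^ (1 / 2 : ℝ)) := by ring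
      _ ≤ K * L * a ^ (1 / 2 : ℝ) * a ^ (α - 1 + 1 / 2) := by gcongr
      _ = K * L * a ^ α := by
        rw [mul_assoc _ (a ^ (1 / 2 : ℝ)), ← Real.rpow_add ha]
        congr 2
        ring
      _ = _ := by field_simp
  obtain ⟨T, hT, hT'⟩ := exists_trigPoly_of_hasDerivAt L (periodic_comp_halfAngle lam h₀)
    (fun t => (hd₀ _).comp t (hasDerivAt_halfAngle lam t)) happ
  obtain ⟨P, hP, hP'⟩ := exists_polynomial_of_trigPoly hlam0 hT (E := 13 * K * a ^ α)
    fun t => (hT' t).trans (by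
      have h0 : (0 : ℝ) < L := by exact_mod_cast hL
      rw [div_le_iff₀ (by positivity), show 13 * (K * a ^ α / a * (L * a)) = 13 * K * a ^ α * L by
        field_simp]
      gcongr
      linarith)
  refine ⟨P, hP, ?_⟩
  rw [add_mul]
  refine abs_sub_eval_le_of_comparison hlam0 hφ0
    (continuous_iff_continuousAt.2 fun x => (hd₀ x).continuousAt) (fun x hx => ?_) hP'
  rcases le_total a x with hax | hax
  · rw [he₀ x ⟨hax, hx.2⟩, sub_self, abs_zero]
    positivity
  · have h1 := abs_sub_le_of_abs_deriv_le_rpow (F := fun s => φ s - h₀ s) (M := 2 * K)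
      hα0.ne' hx.1 hax
      (fun s hs => (hφ s ⟨hx.1.trans_le hs.1, hs.2.trans hal⟩).sub (hd₀ s)) (fun s hs => by
        have hs0 : 0 < s := hx.1.trans_le hs.1
        have h2 := hb s ⟨hs0, hs.2.trans hal⟩
        have h3 := abs_comp_clamp_le ha hal hb (hs.2.trans hal)
        rw [max_eq_left hs.2] at h3
        have h4 : a ^ (α - 1) ≤ s ^ (α - 1) :=
          Real.rpow_le_rpow_of_nonpos hs0 hs.2 (by linarith [hα.2])
        have h5 : K * a ^ (α - 1) ≤ K * s ^ (α - 1) := by gcongr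
        refine (abs_sub _ _).trans ?_
        linarith)
    rw [he₀ a ⟨le_rfl, hal⟩, sub_self, zero_sub, abs_neg] at h1
    refine h1.trans (mul_le_mul_of_nonneg_left ?_ (by positivity))
    have := Real.rpow_pos_of_pos hx.1 α
    linarith

theorem exists_polynomial_of_second_deriv_bound {φ ψ₁ ψ₂ : ℝ → ℝ} {α K a lam : ℝ} {L : ℕ}
    (hα : α ∈ Set.Ioc (1 / 2 : ℝ) 1) (hL : 1 ≤ L) (ha : 0 < a) (hlam : lam = (L : ℝ) ^ 2 * a)
    (hφ0 : ContinuousWithinAt φ (Set.Icc 0 lam) 0)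
    (hφ : ∀ p ∈ Set.Ioc 0 lam, HasDerivAt φ (ψ₁ p) p)
    (hψ : ∀ p ∈ Set.Ioc 0 lam, HasDerivAt ψ₁ (ψ₂ p) p) (hc : ContinuousOn ψ₂ (Set.Ioc 0 lam))
    (hb : ∀ p ∈ Set.Ioc 0 lam, |ψ₂ p| ≤ K * p ^ (α - 2)) :
    ∃ P : Polynomial ℝ, P.natDegree ≤ L ∧
      ∀ x ∈ Set.Icc 0 lam, |φ x - P.eval x| ≤
        (2 * K / (3 / 2 - α) / (α - 1 / 2) + 676 * (8 * K)) * a ^ α := by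
  have hal : a ≤ lam := hlam ▸ le_sq_mul hL ha
  have hlam0 : 0 < lam := ha.trans_le hal
  have hK : 0 ≤ K := const_nonneg_of_bound hlam0 hb
  have hα1 : 0 < α - 1 / 2 := by linarith [hα.1]
  have hα2 : 0 < 3 / 2 - α := by linarith [hα.2]
  have hIcc : Set.Icc a lam ⊆ Set.Ioc 0 lam := fun x hx => ⟨ha.trans_le hx.1, hx.2⟩
  have hHc := continuous_comp_clamp hal (hc.mono hIcc)
  obtain ⟨h₁, hd₁, he₁⟩ := exists_primitive_eqOn (fun p hp => hψ p (hIcc hp)) hHc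
    fun x hx => comp_clamp_eq hx
  obtain ⟨h₀, hd₀, he₀⟩ := exists_primitive_eqOn (fun p hp => hφ p (hIcc hp))
    (continuous_iff_continuousAt.2 fun x => (hd₁ x).continuousAt) he₁
  have hL0 : (0 : ℝ) < L := by exact_mod_cast hL
  have happ : ∀ t, |ψ₂ (max a (min (lam * (1 - Real.cos t) / 2) lam)) * (lam * Real.sin t / 2)| ≤
      K * a ^ α / a * L := fun t => by
    have hx := halfAngle_mem lam t hlam0.le
    have h1 := abs_comp_clamp_le ha hal hb hx.2
    have h2 := abs_halfAngle_deriv_le lam t ha (Nat.cast_nonneg L) hlam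
    set m := max a (lam * (1 - Real.cos t) / 2)
    have hm : a ≤ m := le_max_left _ _
    have hm0 := ha.trans_le hm
    have h3 := rpow_mul_rpow_le ha hm (p := α - 2) (q := 1 / 2) (by linarith [hα.2])
    rw [abs_mul]
    calc _ ≤ (K * m ^ (α - 2)) * (L * a ^ (1 / 2 : ℝ) * m ^ (1 / 2 : ℝ)) := by gcongr
      _ = K * L * a ^ (1 / 2 : ℝ) * (m ^ (α - 2) * m ^ (1 / 2 : ℝ)) := by ring
      _ ≤ K * L * a ^ (1 / 2 : ℝ) * a ^ (α - 2 + 1 / 2) := by gcongr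
      _ = K * L * a ^ (α - 1) := by
        rw [mul_assoc _ (a ^ (1 / 2 : ℝ)), ← Real.rpow_add ha]
        congr 2
        ring
      _ = _ := by
        rw [Real.rpow_sub_one ha.ne']
        ring
  have happ2 : ∀ t, |ψ₂ (max a (min (lam * (1 - Real.cos t) / 2) lam)) *
      (lam * Real.sin t / 2) ^ 2| ≤ K * a ^ α * L ^ 2 := fun t => by
    have hx := halfAngle_mem lam t hlam0.le
    have h1 := abs_comp_clamp_le ha hal hb hx.2
    have h2 := abs_halfAngle_deriv_le lam t ha (Nat.cast_nonneg L) hlam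
    set m := max a (lam * (1 - Real.cos t) / 2)
    have hm : a ≤ m := le_max_left _ _
    have hm0 := ha.trans_le hm
    have h3 := rpow_mul_rpow_le ha hm (p := α - 2) (q := 1) (by linarith [hα.2])
    have e1 : ∀ y : ℝ, 0 < y → (y ^ (1 / 2 : ℝ)) ^ 2 = y := fun y hy => by
      rw [← Real.sqrt_eq_rpow, Real.sq_sqrt hy.le]
    rw [abs_mul, abs_pow]
    calc _ ≤ (K * m ^ (α - 2)) * (L * a ^ (1 / 2 : ℝ) * m ^ (1 / 2 : ℝ)) ^ 2 := by gcongr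
      _ = K * L ^ 2 * a * (m ^ (α - 2) * m ^ (1 : ℝ)) := by
        rw [mul_pow, mul_pow, e1 a ha, e1 m hm0, Real.rpow_one]
        ring
      _ ≤ K * L ^ 2 * a * a ^ (α - 2 + 1) := by gcongr
      _ = K * L ^ 2 * (a ^ (1 : ℝ) * a ^ (α - 2 + 1)) := by rw [Real.rpow_one]; ring
      _ = K * L ^ 2 * a ^ α := by
        rw [← Real.rpow_add ha]
        congr 2
        ring
      _ = _ := by ring
  obtain ⟨u, hu, hu'⟩ := exists_trigPoly_of_hasDerivAt (L - 1) (periodic_comp_halfAngle lam h₁)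
    (fun t => (hd₁ _).comp t (hasDerivAt_halfAngle lam t)) happ
  have hq := (trigPoly (L - 1 + 1)).smul_mem (lam / 2) (mul_cos_mem_trigPoly hu)
  rw [Nat.sub_add_cancel hL] at hq
  obtain ⟨P, hP, hP'⟩ := exists_polynomial_of_second_deriv_approx (E := 8 * K * a ^ α) hL hlam0
    hd₀ hd₁ hq fun t => by
      have h1 := happ2 t
      have h2 := hu' t
      have hcast : ((L - 1 : ℕ) : ℝ) + 1 = L := by
        rw [Nat.cast_sub hL]
        push_cast
        ring
      rw [hcast, show 13 * (K * a ^ α / a * L) / L = 13 * K * a ^ α / a by field_simp] at h2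
      have h3 : |(h₁ (lam * (1 - Real.cos t) / 2) - u t) * (lam * Real.cos t / 2)| ≤
          7 * (K * a ^ α * L ^ 2) := by
        have h4 : |lam * Real.cos t / 2| ≤ lam / 2 := by
          rw [mul_div_right_comm, abs_mul, abs_of_pos (by positivity : 0 < lam / 2)]
          exact mul_le_of_le_one_right (by positivity) (Real.abs_cos_le_one t)
        rw [abs_mul]
        calc _ ≤ 13 * K * a ^ α / a * (lam / 2) := by gcongr
          _ = 13 / 2 * (K * a ^ α * L ^ 2) := by rw [hlam]; field_simp
          _ ≤ _ := by
            refine mul_le_mul_of_nonneg_right (by norm_num) (by positivity)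
      calc _ = |ψ₂ (max a (min (lam * (1 - Real.cos t) / 2) lam)) * (lam * Real.sin t / 2) ^ 2 +
            (h₁ (lam * (1 - Real.cos t) / 2) - u t) * (lam * Real.cos t / 2)| := by
            congr 1
            simp only [Pi.smul_apply, smul_eq_mul]
            ring
        _ ≤ _ := (abs_add_le _ _).trans (by linarith)
  refine ⟨P, hP, ?_⟩
  rw [add_mul]
  have hP'' : ∀ x ∈ Set.Icc 0 lam, |h₀ x - P.eval x| ≤ 676 * (8 * K) * a ^ α := fun x hx =>
    (hP' x hx).trans_eq (by ring)
  refine abs_sub_eval_le_of_comparison hlam0 hφ0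
    (continuous_iff_continuousAt.2 fun x => (hd₀ x).continuousAt) (fun x hx => ?_) hP''
  rcases le_total a x with hax | hax
  · rw [he₀ x ⟨hax, hx.2⟩, sub_self, abs_zero]
    positivity
  · have hsub : ∀ s ∈ Set.Ioc 0 a, s ∈ Set.Ioc 0 lam := fun s hs => ⟨hs.1, hs.2.trans hal⟩
    refine abs_sub_le_of_abs_second_deriv_sub_le ⟨hα.1, by linarith [hα.2]⟩
      (fun s hs => hφ s (hsub s hs)) (fun s hs => hψ s (hsub s hs)) hd₀ hd₁
      (he₀ a ⟨le_rfl, hal⟩) (he₁ a ⟨le_rfl, hal⟩) (by positivity) (fun s hs => ?_) x ⟨hx.1, hax⟩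
    have h2 := hb s (hsub s hs)
    have h3 := abs_comp_clamp_le ha hal hb (hs.2.trans hal)
    rw [max_eq_left hs.2] at h3
    have h4 : a ^ (α - 2) ≤ s ^ (α - 2) :=
      Real.rpow_le_rpow_of_nonpos hs.1 hs.2 (by linarith [hα.2])
    have h5 : K * a ^ (α - 2) ≤ K * s ^ (α - 2) := by gcongr
    refine (abs_sub _ _).trans ?_
    linarith

theorem exists_polynomial_of_third_deriv_bound {φ ψ₁ ψ₂ ψ₃ : ℝ → ℝ} {α K K₂ a lam : ℝ} {L : ℕ}
    (hα : α ∈ Set.Ioo (1 : ℝ) (3 / 2)) (hL : 1 ≤ L) (ha : 0 < a) (hlam : lam = (L : ℝ) ^ 2 * a)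
    (hφ0 : ContinuousWithinAt φ (Set.Icc 0 lam) 0)
    (hφ : ∀ p ∈ Set.Ioc 0 lam, HasDerivAt φ (ψ₁ p) p)
    (hψ : ∀ p ∈ Set.Ioc 0 lam, HasDerivAt ψ₁ (ψ₂ p) p)
    (hψ₂ : ∀ p ∈ Set.Ioc 0 lam, HasDerivAt ψ₂ (ψ₃ p) p) (hc : ContinuousOn ψ₃ (Set.Ioc 0 lam))
    (hb₂ : ∀ p ∈ Set.Ioc 0 lam, |ψ₂ p| ≤ K₂ * p ^ (α - 2))
    (hb : ∀ p ∈ Set.Ioc 0 lam, |ψ₃ p| ≤ K * p ^ (α - 3)) (h0 : ψ₁ lam = 0) :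
    ∃ P : Polynomial ℝ, P.natDegree ≤ L ∧
      ∀ x ∈ Set.Icc 0 lam, |φ x - P.eval x| ≤
        (2 * (K₂ + K) / (3 / 2 - α) / (α - 1 / 2) +
          676 * (13 * (K + 2 * (K₂ + K) + (K₂ + K) / (α - 1)))) * a ^ α := by
  have hal : a ≤ lam := hlam ▸ le_sq_mul hL ha
  have hlam0 : 0 < lam := ha.trans_le hal
  have hK : 0 ≤ K := const_nonneg_of_bound hlam0 hb
  have hK₂ : 0 ≤ K₂ := const_nonneg_of_bound hlam0 hb₂
  have hα0 : 0 < α - 1 := by linarith [hα.1]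
  have hα1 : 0 < α - 1 / 2 := by linarith [hα.1]
  have hα2 : 0 < 3 / 2 - α := by linarith [hα.2]
  have hIcc : Set.Icc a lam ⊆ Set.Ioc 0 lam := fun x hx => ⟨ha.trans_le hx.1, hx.2⟩
  have hHc := continuous_comp_clamp hal (hc.mono hIcc)
  obtain ⟨h₂, hd₂, he₂⟩ := exists_primitive_eqOn (fun p hp => hψ₂ p (hIcc hp)) hHc
    fun x hx => comp_clamp_eq hx
  obtain ⟨h₁, hd₁, he₁⟩ := exists_primitive_eqOn (fun p hp => hψ p (hIcc hp))
    (continuous_iff_continuousAt.2 fun x => (hd₂ x).continuousAt) he₂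
  obtain ⟨h₀, hd₀, he₀⟩ := exists_primitive_eqOn (fun p hp => hφ p (hIcc hp))
    (continuous_iff_continuousAt.2 fun x => (hd₁ x).continuousAt) he₁
  have hL0 : (0 : ℝ) < L := by exact_mod_cast hL
  have bound₂ : ∀ x ∈ Set.Icc 0 lam, |h₂ x| ≤ (K₂ + K) * (max a x) ^ (α - 2) := fun x hx => by
    rcases le_total a x with hax | hax
    · rw [max_eq_right hax, he₂ x ⟨hax, hx.2⟩]
      refine (hb₂ x ⟨ha.trans_le hax, hx.2⟩).trans ?_
      have hx0 := ha.trans_le hax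
      gcongr
      linarith
    · rw [max_eq_left hax]
      have h1 := Convex.norm_image_sub_le_of_norm_hasDerivWithin_le (f := h₂) (s := Set.Icc 0 a)
        (x := a) (y := x) (C := K * a ^ (α - 3)) (fun s hs => (hd₂ s).hasDerivWithinAt)
        (fun s hs => by
          have h3 := abs_comp_clamp_le ha hal hb (hs.2.trans hal)
          rw [max_eq_left hs.2] at h3
          exact h3) (convex_Icc 0 a) ⟨ha.le, le_rfl⟩ ⟨hx.1, hax⟩
      rw [Real.norm_eq_abs, Real.norm_eq_abs, he₂ a ⟨le_rfl, hal⟩] at h1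
      have h2 := hb₂ a ⟨ha, hal⟩
      have h3 : |x - a| ≤ a := by
        rw [abs_le]
        constructor <;> linarith [hx.1]
      have h4 : K * a ^ (α - 3) * |x - a| ≤ K * a ^ (α - 2) := by
        calc _ ≤ K * a ^ (α - 3) * a := by gcongr
          _ = K * a ^ (α - 2) := by
            rw [show α - 3 = α - 2 - 1 by ring, Real.rpow_sub_one ha.ne']
            field_simp
      have h5 : |h₂ x| ≤ |h₂ x - ψ₂ a| + |ψ₂ a| := by
        have := abs_add_le (h₂ x - ψ₂ a) (ψ₂ a)
        rwa [sub_add_cancel] at this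
      linarith
  have bound₁ : ∀ x ∈ Set.Icc 0 lam, |h₁ x| ≤ (K₂ + K) / (α - 1) * lam ^ (α - 1) := by
    have hpos : ∀ x ∈ Set.Ioc 0 lam, |h₁ x| ≤ (K₂ + K) / (α - 1) * lam ^ (α - 1) := fun x hx => by
      have h1 := abs_sub_le_of_abs_deriv_le_rpow (F := h₁) (M := K₂ + K) hα0.ne' hx.1 hx.2
        (fun s hs => hd₁ s) (fun s hs => by
          have hs0 := hx.1.trans_le hs.1
          refine (bound₂ s ⟨hs0.le, hs.2⟩).trans ?_
          rw [show α - 1 - 1 = α - 2 by ring]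
          refine mul_le_mul_of_nonneg_left ?_ (by positivity)
          exact Real.rpow_le_rpow_of_nonpos hs0 (le_max_right _ _) (by linarith))
      rw [he₁ lam ⟨hal, le_rfl⟩, h0, zero_sub, abs_neg] at h1
      refine h1.trans (mul_le_mul_of_nonneg_left ?_ (by positivity))
      have := Real.rpow_pos_of_pos hx.1 (α - 1)
      linarith
    intro x hx
    rcases hx.1.eq_or_lt with hx0 | hx0
    · rw [← hx0]
      exact abs_le_at_zero hlam0 (hd₁ 0).continuousAt.continuousWithinAt hpos
    · exact hpos x ⟨hx0, hx.2⟩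
  set x : ℝ → ℝ := fun t => lam * (1 - Real.cos t) / 2 with hxdef
  have hx1 : ∀ t, HasDerivAt x (lam * Real.sin t / 2) t := hasDerivAt_halfAngle lam
  have hderiv : ∀ t, HasDerivAt (fun t => h₂ (x t) * (lam * Real.sin t / 2) ^ 2 +
      h₁ (x t) * (lam * Real.cos t / 2))
      (ψ₃ (max a (min (x t) lam)) * (lam * Real.sin t / 2) ^ 3 +
        3 * (h₂ (x t) * (lam * Real.sin t / 2) * (lam * Real.cos t / 2)) -
        h₁ (x t) * (lam * Real.sin t / 2)) t := fun t => by
    have A := ((hd₂ (x t)).comp t (hx1 t)).mul ((hasDerivAt_halfAngle_deriv lam t).pow 2)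
    have B := ((hd₁ (x t)).comp t (hx1 t)).mul (hasDerivAt_halfAngle_deriv_two lam t)
    refine (A.add B).congr_deriv ?_
    simp only [Function.comp_apply, Pi.pow_apply]
    push_cast
    ring
  have hbound : ∀ t, |ψ₃ (max a (min (x t) lam)) * (lam * Real.sin t / 2) ^ 3 +
        3 * (h₂ (x t) * (lam * Real.sin t / 2) * (lam * Real.cos t / 2)) -
        h₁ (x t) * (lam * Real.sin t / 2)| ≤
      (K + 2 * (K₂ + K) + (K₂ + K) / (α - 1)) * (a ^ α * L ^ 3) := fun t => by
    have hx := halfAngle_mem lam t hlam0.le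
    have b3 := abs_comp_clamp_le ha hal hb hx.2
    have b2 := bound₂ _ hx
    have b1 := bound₁ _ hx
    have bx := abs_halfAngle_deriv_le lam t ha (Nat.cast_nonneg L) hlam
    change |ψ₃ (max a (min (x t) lam))| ≤ K * (max a (x t)) ^ (α - 3) at b3
    change |h₂ (x t)| ≤ (K₂ + K) * (max a (x t)) ^ (α - 2) at b2
    change |h₁ (x t)| ≤ _ at b1
    change _ ≤ L * a ^ (1 / 2 : ℝ) * (max a (x t)) ^ (1 / 2 : ℝ) at bx
    set m := max a (x t)
    have hm : a ≤ m := le_max_left _ _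
    have hm0 := ha.trans_le hm
    have e1 : ∀ y : ℝ, 0 < y → (y ^ (1 / 2 : ℝ)) ^ 3 = y ^ (3 / 2 : ℝ) := fun y hy => by
      rw [← Real.rpow_natCast, ← Real.rpow_mul hy.le]
      norm_num
    have e2 : a ^ (3 / 2 : ℝ) * a ^ (α - 3 / 2) = a ^ α := by
      rw [← Real.rpow_add ha]
      congr 1
      ring
    have hcos : |lam * Real.cos t / 2| ≤ lam / 2 := by
      rw [mul_div_right_comm, abs_mul, abs_of_pos (by positivity : 0 < lam / 2)]
      exact mul_le_of_le_one_right (by positivity) (Real.abs_cos_le_one t)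
    have hsin : |lam * Real.sin t / 2| ≤ lam := by
      rw [mul_div_right_comm, abs_mul, abs_of_pos (by positivity : 0 < lam / 2)]
      refine (mul_le_of_le_one_right (by positivity) (Real.abs_sin_le_one t)).trans ?_
      linarith
    have t1 : |ψ₃ (max a (min (x t) lam)) * (lam * Real.sin t / 2) ^ 3| ≤ K * (a ^ α * L ^ 3) := by
      have h3 := rpow_mul_rpow_le ha hm (p := α - 3) (q := 3 / 2) (by linarith)
      rw [show α - 3 + 3 / 2 = α - 3 / 2 by ring] at h3
      rw [abs_mul, abs_pow]
      calc _ ≤ (K * m ^ (α - 3)) * (L * a ^ (1 / 2 : ℝ) * m ^ (1 / 2 : ℝ)) ^ 3 := by gcongr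
        _ = K * L ^ 3 * a ^ (3 / 2 : ℝ) * (m ^ (α - 3) * m ^ (3 / 2 : ℝ)) := by
          rw [mul_pow, mul_pow, e1 a ha, e1 m hm0]
          ring
        _ ≤ K * L ^ 3 * a ^ (3 / 2 : ℝ) * a ^ (α - 3 / 2) := by gcongr
        _ = K * L ^ 3 * (a ^ (3 / 2 : ℝ) * a ^ (α - 3 / 2)) := by ring
        _ = _ := by rw [e2]; ring
    have t2 : |3 * (h₂ (x t) * (lam * Real.sin t / 2) * (lam * Real.cos t / 2))| ≤
        2 * (K₂ + K) * (a ^ α * L ^ 3) := by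
      have h3 := rpow_mul_rpow_le ha hm (p := α - 2) (q := 1 / 2) (by linarith)
      rw [show α - 2 + 1 / 2 = α - 3 / 2 by ring] at h3
      have e3 : a ^ (1 / 2 : ℝ) * a = a ^ (3 / 2 : ℝ) := by
        rw [← Real.rpow_add_one ha.ne']
        norm_num
      rw [abs_mul, abs_mul, abs_mul, abs_of_pos (by norm_num : (0 : ℝ) < 3)]
      calc _ ≤ 3 * (((K₂ + K) * m ^ (α - 2)) * (L * a ^ (1 / 2 : ℝ) * m ^ (1 / 2 : ℝ)) *
            (lam / 2)) := by gcongr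
        _ = 3 / 2 * (K₂ + K) * L ^ 3 * (a ^ (1 / 2 : ℝ) * a) * (m ^ (α - 2) * m ^ (1 / 2 : ℝ)) := by
          rw [hlam]
          ring
        _ ≤ 3 / 2 * (K₂ + K) * L ^ 3 * (a ^ (1 / 2 : ℝ) * a) * a ^ (α - 3 / 2) := by gcongr
        _ = 3 / 2 * (K₂ + K) * L ^ 3 * (a ^ (3 / 2 : ℝ) * a ^ (α - 3 / 2)) := by rw [e3]; ring
        _ = 3 / 2 * ((K₂ + K) * (a ^ α * L ^ 3)) := by rw [e2]; ring
        _ ≤ 2 * ((K₂ + K) * (a ^ α * L ^ 3)) :=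
          mul_le_mul_of_nonneg_right (by norm_num) (by positivity)
        _ = _ := by ring
    have t3 : |h₁ (x t) * (lam * Real.sin t / 2)| ≤ (K₂ + K) / (α - 1) * (a ^ α * L ^ 3) := by
      have h3 : lam ^ (α - 3 / 2) ≤ a ^ (α - 3 / 2) :=
        Real.rpow_le_rpow_of_nonpos ha hal (by linarith)
      have h4 : lam ^ (3 / 2 : ℝ) = L ^ 3 * a ^ (3 / 2 : ℝ) := by
        rw [hlam, Real.mul_rpow (by positivity) ha.le, ← Real.rpow_natCast (L : ℝ) 2,
          ← Real.rpow_mul hL0.le, ← Real.rpow_natCast (L : ℝ) 3]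
        norm_num
      rw [abs_mul]
      calc _ ≤ (K₂ + K) / (α - 1) * lam ^ (α - 1) * lam := by gcongr
        _ = (K₂ + K) / (α - 1) * (lam ^ (3 / 2 : ℝ) * lam ^ (α - 3 / 2)) := by
          rw [mul_assoc, ← Real.rpow_add_one hlam0.ne', ← Real.rpow_add hlam0]
          congr 2
          ring
        _ ≤ (K₂ + K) / (α - 1) * (lam ^ (3 / 2 : ℝ) * a ^ (α - 3 / 2)) := by gcongr
        _ = (K₂ + K) / (α - 1) * (L ^ 3 * (a ^ (3 / 2 : ℝ) * a ^ (α - 3 / 2))) := by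
          rw [h4]
          ring
        _ = _ := by rw [e2]; ring
    refine (abs_sub _ _).trans ?_
    refine (add_le_add (abs_add_le _ _) le_rfl).trans ?_
    calc _ ≤ _ := add_le_add (add_le_add t1 t2) t3
      _ = _ := by ring
  obtain ⟨q, hq, hq'⟩ := exists_trigPoly_of_hasDerivAt L
    (fun t => by simp only [hxdef, Real.cos_add_two_pi, Real.sin_add_two_pi]) hderiv hbound
  obtain ⟨P, hP, hP'⟩ := exists_polynomial_of_second_deriv_approx
    (E := 13 * (K + 2 * (K₂ + K) + (K₂ + K) / (α - 1)) * a ^ α) hL hlam0 hd₀ hd₁ hq fun t => by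
      refine (hq' t).trans ?_
      rw [div_le_iff₀ (by positivity)]
      calc _ = 13 * (K + 2 * (K₂ + K) + (K₂ + K) / (α - 1)) * a ^ α * L ^ 2 * L := by ring
        _ ≤ _ := by
          gcongr
          linarith
  refine ⟨P, hP, ?_⟩
  rw [add_mul]
  have hP'' : ∀ x ∈ Set.Icc 0 lam, |h₀ x - P.eval x| ≤
      676 * (13 * (K + 2 * (K₂ + K) + (K₂ + K) / (α - 1))) * a ^ α := fun x hx =>
    (hP' x hx).trans_eq (by ring)
  refine abs_sub_eval_le_of_comparison hlam0 hφ0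
    (continuous_iff_continuousAt.2 fun x => (hd₀ x).continuousAt) (fun x hx => ?_) hP''
  rcases le_total a x with hax | hax
  · rw [he₀ x ⟨hax, hx.2⟩, sub_self, abs_zero]
    positivity
  · have hsub : ∀ s ∈ Set.Ioc 0 a, s ∈ Set.Ioc 0 lam := fun s hs => ⟨hs.1, hs.2.trans hal⟩
    refine abs_sub_le_of_abs_second_deriv_sub_le ⟨by linarith, by linarith⟩
      (fun s hs => hφ s (hsub s hs)) (fun s hs => hψ s (hsub s hs)) hd₀ hd₁
      (he₀ a ⟨le_rfl, hal⟩) (he₁ a ⟨le_rfl, hal⟩) (by positivity) (fun s hs => ?_) x ⟨hx.1, hax⟩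
    have h2 := hb₂ s (hsub s hs)
    have h3 := bound₂ s ⟨hs.1.le, hs.2.trans hal⟩
    rw [max_eq_left hs.2] at h3
    have h4 : a ^ (α - 2) ≤ s ^ (α - 2) :=
      Real.rpow_le_rpow_of_nonpos hs.1 hs.2 (by linarith)
    have h5 : (K₂ + K) * a ^ (α - 2) ≤ (K₂ + K) * s ^ (α - 2) := by gcongr
    have h6 : 0 ≤ K * s ^ (α - 2) := mul_nonneg hK (Real.rpow_nonneg hs.1.le _)
    refine (abs_sub _ _).trans ?_
    linarith

theorem HasDivergenceSpeed.hasDerivAt_iteratedDeriv {ℓ k : ℕ} {φ : ℝ → ℝ} {α p : ℝ}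
    (h : HasDivergenceSpeed ℓ φ α) (hk : k < ℓ) (hp : p ∈ Set.Ioo (0 : ℝ) 1) :
    HasDerivAt (iteratedDeriv k φ) (iteratedDeriv (k + 1) φ p) p := by
  have h1 := h.1.differentiableOn_iteratedDerivWithin (m := k) (by exact_mod_cast hk)
    isOpen_Ioo.uniqueDiffOn
  have h2 : DifferentiableOn ℝ (iteratedDeriv k φ) (Set.Ioo 0 1) :=
    h1.congr fun x hx => (iteratedDerivWithin_of_isOpen isOpen_Ioo hx).symm
  rw [iteratedDeriv_succ]
  exact (h2.differentiableAt (isOpen_Ioo.mem_nhds hp)).hasDerivAt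

theorem HasDivergenceSpeed.continuousOn_iteratedDeriv {ℓ : ℕ} {φ : ℝ → ℝ} {α : ℝ}
    (h : HasDivergenceSpeed ℓ φ α) : ContinuousOn (iteratedDeriv ℓ φ) (Set.Ioo 0 1) :=
  (h.1.continuousOn_iteratedDerivWithin le_rfl isOpen_Ioo.uniqueDiffOn).congr
    fun _ hx => (iteratedDerivWithin_of_isOpen isOpen_Ioo hx).symm

theorem HasDivergenceSpeed.exists_bound {ℓ : ℕ} {φ : ℝ → ℝ} {α : ℝ}
    (h : HasDivergenceSpeed ℓ φ α) (hα : α ≤ ℓ) :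
    ∃ K : ℝ, 0 < K ∧ ∀ p ∈ Set.Ioo (0 : ℝ) 1, |iteratedDeriv ℓ φ p| ≤ K * p ^ (α - ℓ) := by
  obtain ⟨-, W, c, c', hW, hc, -, hb⟩ := h
  refine ⟨W + c, by positivity, fun p hp => (hb p hp).2.trans ?_⟩
  rw [show -(ℓ : ℝ) + α = α - ℓ by ring, add_mul]
  have h1 : 1 ≤ p ^ (α - ℓ) :=
    Real.one_le_rpow_of_pos_of_le_one_of_nonpos hp.1 hp.2.le (by linarith)
  have h2 : c * 1 ≤ c * p ^ (α - ℓ) := by gcongr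
  linarith

theorem exists_bound_of_deriv_bound {ψ ψ' : ℝ → ℝ} {K e : ℝ} (he : e < 0) (hK : 0 < K)
    (hψ : ∀ p ∈ Set.Ioo (0 : ℝ) 1, HasDerivAt ψ (ψ' p) p)
    (hb : ∀ p ∈ Set.Ioo (0 : ℝ) 1, |ψ' p| ≤ K * p ^ (e - 1)) :
    ∃ K₂ : ℝ, 0 ≤ K₂ ∧ ∀ p ∈ Set.Ioo (0 : ℝ) 1, |ψ p| ≤ K₂ * p ^ e := by
  have key : ∀ x y : ℝ, 0 < x → x ≤ y → y < 1 → |ψ y - ψ x| ≤ K / -e * (x ^ e + y ^ e) := by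
    intro x y hx hxy hy
    have hmem : ∀ s ∈ Set.Icc x y, s ∈ Set.Ioo (0 : ℝ) 1 :=
      fun s hs => ⟨hx.trans_le hs.1, hs.2.trans_lt hy⟩
    refine (abs_sub_le_of_abs_deriv_le_rpow he.ne hx hxy (fun s hs => hψ s (hmem s hs))
      fun s hs => hb s (hmem s hs)).trans ?_
    rw [show K / e * (y ^ e - x ^ e) = K / -e * (x ^ e - y ^ e) by rw [div_neg]; ring]
    have hy0 : 0 < y ^ e := Real.rpow_pos_of_pos (hx.trans_le hxy) e
    have : 0 < -e := by linarith
    refine mul_le_mul_of_nonneg_left ?_ (by positivity)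
    linarith
  have he' : 0 < -e := by linarith
  refine ⟨|ψ (1 / 2)| + K / -e * (1 + (1 / 2 : ℝ) ^ e), by positivity, fun p hp => ?_⟩
  have h1 : 1 ≤ p ^ e := Real.one_le_rpow_of_pos_of_le_one_of_nonpos hp.1 hp.2.le he.le
  have h2 : |ψ p - ψ (1 / 2)| ≤ K / -e * (p ^ e + (1 / 2 : ℝ) ^ e) := by
    rcases le_total p (1 / 2) with h | h
    · rw [abs_sub_comm]
      exact key p (1 / 2) hp.1 h (by norm_num)
    · rw [add_comm]
      exact key (1 / 2) p (by norm_num) h hp.2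
  have h3 : |ψ p| ≤ |ψ p - ψ (1 / 2)| + |ψ (1 / 2)| := by
    have := abs_add_le (ψ p - ψ (1 / 2)) (ψ (1 / 2))
    rwa [sub_add_cancel] at this
  have h4 : 0 < (1 / 2 : ℝ) ^ e := by positivity
  have h5 : p ^ e + (1 / 2 : ℝ) ^ e ≤ (1 + (1 / 2 : ℝ) ^ e) * p ^ e := by nlinarith
  calc |ψ p| ≤ K / -e * ((1 + (1 / 2 : ℝ) ^ e) * p ^ e) + |ψ (1 / 2)| * p ^ e := by
        refine h3.trans (add_le_add (h2.trans (by gcongr)) ?_)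
        exact le_mul_of_one_le_right (abs_nonneg _) h1
    _ = _ := by ring

theorem bestPolyError_le {L : ℕ} {φ : ℝ → ℝ} {I : Set ℝ} {E : ℝ} {P : Polynomial ℝ}
    (hP : P.natDegree ≤ L) (hE : ∀ x ∈ I, |φ x - P.eval x| ≤ E) :
    bestPolyError L φ I ≤ ENNReal.ofReal E :=
  iInf₂_le_of_le P hP (iSup₂_le fun x hx => ENNReal.ofReal_le_ofReal (hE x hx))

theorem mainTheorem10 (φ : ℝ → ℝ) (α : ℝ)
    (hφ0 : ContinuousWithinAt φ (Set.Icc 0 1) 0)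
    (hφ : (α ∈ Set.Ioc (0 : ℝ) (1 / 2) ∧ HasDivergenceSpeed 1 φ α) ∨
      (α ∈ Set.Ioc (1 / 2 : ℝ) 1 ∧ HasDivergenceSpeed 2 φ α) ∨
      (α ∈ Set.Ioo (1 : ℝ) (3 / 2) ∧ HasDivergenceSpeed 3 φ α)) :
    ∃ C : ℝ, 0 < C ∧ ∀ L : ℕ, 1 ≤ L → ∀ lam ∈ Set.Ioo (0 : ℝ) 1,
      bestPolyError L φ (Set.Icc 0 lam) ≤
        ENNReal.ofReal (C * (lam / (L : ℝ) ^ 2) ^ α) := by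
  have hsub : ∀ {lam : ℝ}, lam ∈ Set.Ioo (0 : ℝ) 1 → Set.Ioc 0 lam ⊆ Set.Ioo 0 1 :=
    fun hl x hx => ⟨hx.1, hx.2.trans_lt hl.2⟩
  have hc0 : ∀ {lam : ℝ}, lam ∈ Set.Ioo (0 : ℝ) 1 → ContinuousWithinAt φ (Set.Icc 0 lam) 0 :=
    fun hl => hφ0.mono (Set.Icc_subset_Icc_right hl.2.le)
  have ha : ∀ {L : ℕ} {lam : ℝ}, 1 ≤ L → lam ∈ Set.Ioo (0 : ℝ) 1 → 0 < lam / (L : ℝ) ^ 2 :=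
    fun hL hl => div_pos hl.1 (pow_pos (by exact_mod_cast hL) 2)
  have he : ∀ {L : ℕ} {lam : ℝ}, 1 ≤ L → lam = (L : ℝ) ^ 2 * (lam / (L : ℝ) ^ 2) := fun {L} _ hL => by
    have : (0 : ℝ) < L := by exact_mod_cast hL
    field_simp
  rcases hφ with ⟨hα, h⟩ | ⟨hα, h⟩ | ⟨hα, h⟩
  · obtain ⟨K, hK, hb⟩ := h.exists_bound (by push_cast; linarith [hα.2])
    have hα0 := hα.1
    refine ⟨2 * K / α + 13 * K, by positivity, fun L hL lam hl => ?_⟩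
    obtain ⟨P, hP, hP'⟩ := exists_polynomial_of_first_deriv_bound (φ := φ)
      (ψ₁ := iteratedDeriv 1 φ) hα hL (ha hL hl) (he hL) (hc0 hl)
      (fun p hp => by
        simpa using h.hasDerivAt_iteratedDeriv (k := 0) (by norm_num) (hsub hl hp))
      (h.continuousOn_iteratedDeriv.mono (hsub hl))
      (fun p hp => by simpa using hb p (hsub hl hp))
    exact bestPolyError_le hP hP'
  · obtain ⟨K, hK, hb⟩ := h.exists_bound (by push_cast; linarith [hα.2])
    have hα1 : 0 < α - 1 / 2 := by linarith [hα.1]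
    have hα2 : 0 < 3 / 2 - α := by linarith [hα.2]
    refine ⟨2 * K / (3 / 2 - α) / (α - 1 / 2) + 676 * (8 * K), by positivity,
      fun L hL lam hl => ?_⟩
    obtain ⟨P, hP, hP'⟩ := exists_polynomial_of_second_deriv_bound (φ := φ)
      (ψ₁ := iteratedDeriv 1 φ) (ψ₂ := iteratedDeriv 2 φ) hα hL (ha hL hl) (he hL) (hc0 hl)
      (fun p hp => by
        simpa using h.hasDerivAt_iteratedDeriv (k := 0) (by norm_num) (hsub hl hp))
      (fun p hp => h.hasDerivAt_iteratedDeriv (k := 1) (by norm_num) (hsub hl hp))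
      (h.continuousOn_iteratedDeriv.mono (hsub hl))
      (fun p hp => by simpa using hb p (hsub hl hp))
    exact bestPolyError_le hP hP'
  · obtain ⟨K, hK, hb⟩ := h.exists_bound (by push_cast; linarith [hα.2])
    obtain ⟨K₂, hK₂, hb₂⟩ := exists_bound_of_deriv_bound (e := α - 2) (by linarith [hα.2]) hK
      (fun p hp => h.hasDerivAt_iteratedDeriv (k := 2) (by norm_num) hp)
      (fun p hp => by
        rw [show α - 2 - 1 = α - 3 by ring]
        simpa using hb p hp)
    have hα0 : 0 < α - 1 := by linarith [hα.1]
    have hα1 : 0 < α - 1 / 2 := by linarith [hα.1]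
    have hα2 : 0 < 3 / 2 - α := by linarith [hα.2]
    refine ⟨2 * (K₂ + K) / (3 / 2 - α) / (α - 1 / 2) +
      676 * (13 * (K + 2 * (K₂ + K) + (K₂ + K) / (α - 1))), by positivity, fun L hL lam hl => ?_⟩
    set s := iteratedDeriv 1 φ lam with hs
    obtain ⟨P, hP, hP'⟩ := exists_polynomial_of_third_deriv_bound (φ := fun x => φ x - s * x)
      (ψ₁ := fun x => iteratedDeriv 1 φ x - s) (ψ₂ := iteratedDeriv 2 φ)
      (ψ₃ := iteratedDeriv 3 φ) hα hL (ha hL hl) (he hL)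
      ((hc0 hl).sub (by fun_prop))
      (fun p hp => by
        have h1 := h.hasDerivAt_iteratedDeriv (k := 0) (by norm_num) (hsub hl hp)
        rw [iteratedDeriv_zero] at h1
        exact (h1.sub ((hasDerivAt_id p).const_mul s)).congr_deriv (by simp))
      (fun p hp => (h.hasDerivAt_iteratedDeriv (k := 1) (by norm_num) (hsub hl hp)).sub_const s)
      (fun p hp => h.hasDerivAt_iteratedDeriv (k := 2) (by norm_num) (hsub hl hp))
      (h.continuousOn_iteratedDeriv.mono (hsub hl))
      (fun p hp => hb₂ p (hsub hl hp))
      (fun p hp => by simpa using hb p (hsub hl hp)) (sub_self _)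
    refine bestPolyError_le (P := P + Polynomial.C s * Polynomial.X) ?_ fun x hx => ?_
    · refine (Polynomial.natDegree_add_le _ _).trans (max_le hP ?_)
      exact ((Polynomial.natDegree_C_mul_le _ _).trans Polynomial.natDegree_X_le).trans hL
    · refine le_of_eq_of_le ?_ (hP' x hx)
      simp only [Polynomial.eval_add, Polynomial.eval_mul, Polynomial.eval_C, Polynomial.eval_X]
      congr 1
      ring
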